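/- Let $n,k\ge 1$ be integers with $n\ge 2k$, and let $f\colon\binom{[n]}{k}\to\mathbb{R}$ be a function on the $k$-element subsets of $[n]=\{1,\dots,n\}$. For $1\le r\le k$ define the level-$r$ weight of $f$ by $$W^r(f)=\left(\mathbb{E}_{(a_1,b_1,\ldots,a_r,b_r)}\Big(\mathbb{E}_{R}\,(-1)^{|R\cap\{b_1,\ldots,b_r\}|}f(R)\Big)^2\right)^{1/2},$$ where $(a_1,b_1,\ldots,a_r,b_r)$ is a uniformly random sequence of $2r$ distinct elements of $[n]$ and, given this sequence, $R$ is a uniformly random $k$-subset of $[n]$ satisfying $|R\cap\{a_i,b_i\}|=1$ for each $i\in\{1,\dots,r\}$. Let $\operatorname{Var}[f]$ be the variance of $f(R)$ for a uniformly random $k$-subset $R$ of $[n]$. Then $$\max_{1\le r\le k}W^r(f)\ \ge\ 5^{-k/2}\sqrt{\operatorname{Var}[f]}.$$ -/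

import Mathlib

open scoped BigOperators

noncomputable section

/-- The family of all `k`-element subsets of `V`. -/
abbrev KSubset (V : Type*) (k : ℕ) : Type _ := {R : Finset V // R.card = k}

/-- A `2r`-permutation `(a₁, b₁, …, a_r, b_r)` of `V`, that is, a sequence of `2r` distinct
elements of `V`. The entry `aᵢ` has index `(i, 0)` and the entry `bᵢ` has index `(i, 1)`. -/
abbrev PairPerm (V : Type*) (r : ℕ) : Type _ := Fin r × Fin 2 ↪ V

/-- The `k`-subsets `R` of `V` with `|R ∩ {aᵢ, bᵢ}| = 1` for every `i`. -/
def transversals {V : Type*} [Fintype V] [DecidableEq V] (k : ℕ) {r : ℕ} (p : PairPerm V r) :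
    Finset (KSubset V k) :=
  Finset.univ.filter fun R => ∀ i : Fin r, (R.1 ∩ {p (i, 0), p (i, 1)}).card = 1

/-- The set `{b₁, …, b_r}`. -/
def bSet {V : Type*} [DecidableEq V] {r : ℕ} (p : PairPerm V r) : Finset V :=
  Finset.univ.image fun i : Fin r => p (i, 1)

/-- The level-`r` weight `W^r(f)`; the symbol `𝔼` is the uniform average over a finite set. -/
def levelWeight {V : Type*} [Fintype V] [DecidableEq V] {k : ℕ} (r : ℕ)
    (f : KSubset V k → ℝ) : ℝ :=
  Real.sqrt (𝔼 p : PairPerm V r,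
    (𝔼 R ∈ transversals k p, (-1 : ℝ) ^ (R.1 ∩ bSet p).card * f R) ^ 2)

/-- The variance of `f R` for a uniformly random `k`-subset `R` of `V`. -/
def uniformVar {V : Type*} [Fintype V] [DecidableEq V] {k : ℕ} (f : KSubset V k → ℝ) : ℝ :=
  𝔼 R : KSubset V k, (f R - 𝔼 S : KSubset V k, f S) ^ 2

end

/-! ### Spectral theory of the Johnson graph and a Plancherel identity. -/

section JohnsonScheme

variable {V : Type*}

/-! The proof is a Plancherel identity for the Johnson scheme: `∑ f * g` over `k`-subsets is a
combination, with explicit coefficients, of the forms `levelForm r (k - r)` for `r ≤ k`, and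
`levelForm r` at `f = g` is a positive multiple of `W^r(f)^2`.

Each form is an eigenvector of the Laplacian in its first argument: the derivative along `(a, b)`
intertwines the Laplacian on `X` with the one on `X \ {a, b}` shifted by `|X|`, so iterating gives
the eigenvalue `r (n + 1 - r)` (`levelForm_swapLaplacian_left`). The Dirichlet form
(`dirichletForm_eq`) expresses `⟨f, L g⟩` through first derivatives, hence through the identity for
`k - 1`; dividing by the eigenvalues proves the identity on the image of `L`. Constants are checked
directly, and by connectivity the image of `L` and the constants span everything
(`sum_mul_eq_sum_levelForm`).

The term `r = 0` is the squared mean. The normalised coefficients are at most `2 ^ r * k.choose r`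
(`levelCoeff_mul_le`), so `Var f ≤ ∑_{r ≥ 1} 2 ^ r * k.choose r * W^r(f)^2 ≤ 3 ^ k * max W^2`, which
is stronger than needed. -/

theorem sum_offDiag_swap (X : Finset V) (F : V → V → ℝ) :
    ∑ p ∈ X.offDiag, F p.1 p.2 = ∑ p ∈ X.offDiag, F p.2 p.1 :=
  Finset.sum_bij' (fun p _ => p.swap) (fun p _ => p.swap)
    (fun p hp => by simp only [Finset.mem_offDiag, Prod.fst_swap, Prod.snd_swap] at hp ⊢; tauto)
    (fun p hp => by simp only [Finset.mem_offDiag, Prod.fst_swap, Prod.snd_swap] at hp ⊢; tauto)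
    (by simp) (by simp) (by simp)

variable [DecidableEq V]

/-- The discrete derivative `S ↦ f (S ∪ {a}) - f (S ∪ {b})`. -/
def pairDiff (a b : V) (f : Finset V → ℝ) (S : Finset V) : ℝ :=
  f (insert a S) - f (insert b S)

/-- The Laplacian of the Johnson graph on subsets of `X`. -/
def swapLaplacian (X : Finset V) (f : Finset V → ℝ) (R : Finset V) : ℝ :=
  ∑ a ∈ R, ∑ b ∈ X \ R, (f R - f (insert b (R.erase a)))

/-- The bilinear form summing, over all sequences of `r` disjoint ordered pairs in `X`, the product
of the totals of the iterated derivatives of `f` and `g` over `j`-subsets of the remaining set. -/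
def levelForm : ℕ → ℕ → Finset V → (Finset V → ℝ) → (Finset V → ℝ) → ℝ
  | 0, j, X, f, g => (∑ R ∈ X.powersetCard j, f R) * ∑ R ∈ X.powersetCard j, g R
  | r + 1, j, X, f, g => ∑ p ∈ X.offDiag,
      levelForm r j (X \ {p.1, p.2}) (pairDiff p.1 p.2 f) (pairDiff p.1 p.2 g)

theorem pairDiff_add (a b : V) (f g : Finset V → ℝ) :
    pairDiff a b (f + g) = pairDiff a b f + pairDiff a b g := by
  ext S; simp only [pairDiff, Pi.add_apply]; ring

theorem pairDiff_smul (a b : V) (c : ℝ) (f : Finset V → ℝ) :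
    pairDiff a b (c • f) = c • pairDiff a b f := by
  ext S; simp only [pairDiff, Pi.smul_apply, smul_eq_mul]; ring

theorem levelForm_add_left (r j : ℕ) (X : Finset V) (f₁ f₂ g : Finset V → ℝ) :
    levelForm r j X (f₁ + f₂) g = levelForm r j X f₁ g + levelForm r j X f₂ g := by
  induction r generalizing X f₁ f₂ g with
  | zero => simp only [levelForm, Pi.add_apply, Finset.sum_add_distrib, add_mul]
  | succ r ih => simp only [levelForm, pairDiff_add, ih, Finset.sum_add_distrib]

theorem levelForm_smul_left (r j : ℕ) (X : Finset V) (c : ℝ) (f g : Finset V → ℝ) :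
    levelForm r j X (c • f) g = c * levelForm r j X f g := by
  induction r generalizing X f g with
  | zero => simp only [levelForm, Pi.smul_apply, smul_eq_mul, ← Finset.mul_sum, mul_assoc]
  | succ r ih => simp only [levelForm, pairDiff_smul, ih, Finset.mul_sum]

theorem insert_mem_powersetCard {X S : Finset V} {a b : V} {k : ℕ} (ha : a ∈ X)
    (hS : S ∈ (X \ {a, b}).powersetCard k) : insert a S ∈ X.powersetCard (k + 1) := by
  rw [Finset.mem_powersetCard] at hS ⊢
  have haS : a ∉ S := fun h => by simpa using hS.1 h
  refine ⟨Finset.insert_subset ha (hS.1.trans Finset.sdiff_subset), ?_⟩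
  rw [Finset.card_insert_of_notMem haS, hS.2]

theorem insert_mem_powersetCard' {X S : Finset V} {a b : V} {k : ℕ} (hb : b ∈ X)
    (hS : S ∈ (X \ {a, b}).powersetCard k) : insert b S ∈ X.powersetCard (k + 1) :=
  insert_mem_powersetCard (b := a) hb (by rwa [Finset.pair_comm])

theorem levelForm_congr_left (r j : ℕ) (X : Finset V) {f₁ f₂ : Finset V → ℝ} (g : Finset V → ℝ)
    (h : ∀ R ∈ X.powersetCard (j + r), f₁ R = f₂ R) :
    levelForm r j X f₁ g = levelForm r j X f₂ g := by
  induction r generalizing X f₁ f₂ g with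
  | zero =>
    rw [add_zero] at h
    rw [levelForm, levelForm, Finset.sum_congr rfl h]
  | succ r ih =>
    refine Finset.sum_congr rfl fun p hp => ih _ _ fun S hS => ?_
    obtain ⟨ha, hb, -⟩ := Finset.mem_offDiag.1 hp
    rw [pairDiff, pairDiff, h _ (insert_mem_powersetCard ha hS),
      h _ (insert_mem_powersetCard' hb hS)]

/-- The swaps out of `S ∪ {a}` are sorted by whether they remove `a` and whether they bring in `b`.
-/
theorem swapLaplacian_insert {X S : Finset V} {a b : V} (hb : b ∈ X) (hab : a ≠ b)
    (hS : S ⊆ X \ {a, b}) (f : Finset V → ℝ) :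
    swapLaplacian X f (insert a S) =
      (f (insert a S) - f (insert b S))
      + ∑ y ∈ (X \ {a, b}) \ S, (f (insert a S) - f (insert y S))
      + ∑ x ∈ S, (f (insert a S) - f (insert a (insert b (S.erase x))))
      + ∑ x ∈ S, ∑ y ∈ (X \ {a, b}) \ S,
          (f (insert a S) - f (insert a (insert y (S.erase x)))) := by
  have haS : a ∉ S := fun h => by simpa using hS h
  have hbS : b ∉ S := fun h => by simpa using hS h
  have hX : X \ insert a S = insert b ((X \ {a, b}) \ S) := by
    ext x
    simp only [Finset.mem_sdiff, Finset.mem_insert, Finset.mem_singleton]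
    by_cases hx : x = b
    · subst hx; simp [hb, hab.symm, hbS]
    · simp only [hx]; tauto
  have hbY : b ∉ (X \ {a, b}) \ S := by simp
  rw [swapLaplacian, hX, Finset.sum_insert haS, Finset.sum_insert hbY, Finset.erase_insert haS,
    add_assoc (_ + _), ← Finset.sum_add_distrib]
  congr 1
  refine Finset.sum_congr rfl fun x hx => ?_
  have hxa : a ≠ x := fun h => haS (h ▸ hx)
  rw [Finset.sum_insert hbY, Finset.erase_insert_of_ne hxa, Finset.insert_comm b a]
  congr 1
  exact Finset.sum_congr rfl fun y _ => by rw [Finset.insert_comm y a]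

theorem card_sdiff_pair {X : Finset V} {p : V × V} (hp : p ∈ X.offDiag) :
    (X \ {p.1, p.2}).card + 2 = X.card := by
  obtain ⟨ha, hb, hab⟩ := Finset.mem_offDiag.1 hp
  have h2 : ({p.1, p.2} : Finset V) ⊆ X := by
    intro x hx; simp only [Finset.mem_insert, Finset.mem_singleton] at hx
    rcases hx with rfl | rfl <;> assumption
  have h3 := Finset.card_sdiff_add_card_eq_card h2
  rwa [Finset.card_pair hab] at h3

/-- Subtracting the two expansions, the swap between `a` and `b` contributes `2` copies of the
derivative. The swaps involving just one of `a`, `b` lead to common sets that cancel, leaving one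
copy for each element of `X \ {a, b}`. The remaining swaps form the smaller Laplacian. -/
theorem pairDiff_swapLaplacian {X S : Finset V} {a b : V} (ha : a ∈ X) (hb : b ∈ X) (hab : a ≠ b)
    (hS : S ⊆ X \ {a, b}) (f : Finset V → ℝ) :
    pairDiff a b (swapLaplacian X f) S =
      swapLaplacian (X \ {a, b}) (pairDiff a b f) S + X.card * pairDiff a b f S := by
  have hcard : (X.card : ℝ) = S.card + ((X \ {a, b}) \ S).card + 2 := by
    have h1 := Finset.card_sdiff_add_card_eq_card hS
    have h2 := card_sdiff_pair (p := (a, b)) (Finset.mem_offDiag.2 ⟨ha, hb, hab⟩)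
    dsimp only at h2
    have : X.card = S.card + ((X \ {a, b}) \ S).card + 2 := by omega
    exact_mod_cast this
  have h2 := swapLaplacian_insert (S := S) ha hab.symm (by rwa [Finset.pair_comm]) f
  rw [Finset.pair_comm b a] at h2
  rw [pairDiff, swapLaplacian_insert hb hab hS, h2, hcard]
  simp only [Finset.insert_comm b a, swapLaplacian, pairDiff, Finset.sum_sub_distrib,
    Finset.sum_const, nsmul_eq_mul]
  ring

theorem sum_offDiag_powersetCard (X : Finset V) (k : ℕ) (H : V → V → Finset V → ℝ) :
    ∑ p ∈ X.offDiag, ∑ S ∈ (X \ {p.1, p.2}).powersetCard k, H p.1 p.2 S =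
      ∑ R ∈ X.powersetCard (k + 1), ∑ a ∈ R, ∑ b ∈ X \ R, H a b (R.erase a) := by
  simp only [← Finset.sum_product', Finset.sum_sigma']
  refine Finset.sum_bij' (fun q _ => ⟨insert q.1.1 q.2, (q.1.1, q.1.2)⟩)
    (fun q _ => ⟨(q.2.1, q.2.2), q.1.erase q.2.1⟩) ?_ ?_ ?_ ?_ ?_
  · rintro ⟨⟨a, b⟩, S⟩ h
    simp only [Finset.mem_sigma, Finset.mem_offDiag, Finset.mem_product] at h ⊢
    obtain ⟨⟨ha, hb, hab⟩, hS⟩ := h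
    refine ⟨insert_mem_powersetCard ha hS, Finset.mem_insert_self _ _, ?_⟩
    have hbS : b ∉ S := fun h => by simpa using (Finset.mem_powersetCard.1 hS).1 h
    simp [hb, hab.symm, hbS]
  · rintro ⟨R, a, b⟩ h
    simp only [Finset.mem_sigma, Finset.mem_offDiag, Finset.mem_product, Finset.mem_powersetCard,
      Finset.mem_sdiff] at h ⊢
    obtain ⟨⟨hR, hc⟩, ha, hb, hbR⟩ := h
    refine ⟨⟨hR ha, hb, fun h => hbR (h ▸ ha)⟩, fun x hx => ?_, ?_⟩
    · obtain ⟨hxa, hxR⟩ := Finset.mem_erase.1 hx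
      have hxb : x ≠ b := fun h => hbR (h ▸ hxR)
      simp [hxa, hxb, hR hxR]
    · rw [Finset.card_erase_of_mem ha, hc]; rfl
  · rintro ⟨⟨a, b⟩, S⟩ h
    simp only [Finset.mem_sigma] at h
    have haS : a ∉ S := fun h' => by simpa using (Finset.mem_powersetCard.1 h.2).1 h'
    simp [Finset.erase_insert haS]
  · rintro ⟨R, a, b⟩ h
    simp only [Finset.mem_sigma, Finset.mem_product] at h
    simp [Finset.insert_erase h.2.1]
  · rintro ⟨⟨a, b⟩, S⟩ h
    simp only [Finset.mem_sigma] at h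
    have haS : a ∉ S := fun h' => by simpa using (Finset.mem_powersetCard.1 h.2).1 h'
    simp [Finset.erase_insert haS]

/-- Summation by parts. The factor `2` appears because exchanging `a` and `b` shows that both halves
of `pairDiff a b f` contribute equally. -/
theorem dirichletForm_eq (X : Finset V) (k : ℕ) (f g : Finset V → ℝ) :
    ∑ p ∈ X.offDiag, ∑ S ∈ (X \ {p.1, p.2}).powersetCard k,
        pairDiff p.1 p.2 f S * pairDiff p.1 p.2 g S =
      2 * ∑ R ∈ X.powersetCard (k + 1), f R * swapLaplacian X g R := by
  have key : ∑ p ∈ X.offDiag, ∑ S ∈ (X \ {p.1, p.2}).powersetCard k,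
      f (insert p.1 S) * pairDiff p.1 p.2 g S =
      ∑ R ∈ X.powersetCard (k + 1), f R * swapLaplacian X g R := by
    rw [sum_offDiag_powersetCard X k fun a b S => f (insert a S) * pairDiff a b g S]
    refine Finset.sum_congr rfl fun R _ => ?_
    rw [swapLaplacian, Finset.mul_sum]
    refine Finset.sum_congr rfl fun a ha => ?_
    rw [Finset.mul_sum]
    exact Finset.sum_congr rfl fun b _ => by rw [pairDiff, Finset.insert_erase ha]
  have swap := sum_offDiag_swap X fun a b => ∑ S ∈ (X \ {a, b}).powersetCard k,
    f (insert a S) * pairDiff a b g S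
  rw [two_mul, ← key]
  nth_rw 2 [swap]
  rw [← Finset.sum_add_distrib]
  refine Finset.sum_congr rfl fun p _ => ?_
  rw [Finset.pair_comm p.2 p.1, ← Finset.sum_add_distrib]
  refine Finset.sum_congr rfl fun S _ => ?_
  simp only [pairDiff]
  ring

theorem sum_mul_swapLaplacian_comm (X : Finset V) (k : ℕ) (f g : Finset V → ℝ) :
    ∑ R ∈ X.powersetCard (k + 1), f R * swapLaplacian X g R =
      ∑ R ∈ X.powersetCard (k + 1), swapLaplacian X f R * g R := by
  have h1 := dirichletForm_eq X k f g
  have h2 := dirichletForm_eq X k g f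
  simp only [mul_comm (pairDiff _ _ g _)] at h2
  simp only [mul_comm (swapLaplacian _ _ _)]
  linarith

theorem pairDiff_one (a b : V) : pairDiff a b (1 : Finset V → ℝ) = 0 := by
  ext S; simp [pairDiff]

theorem sum_swapLaplacian (X : Finset V) (k : ℕ) (f : Finset V → ℝ) :
    ∑ R ∈ X.powersetCard k, swapLaplacian X f R = 0 := by
  cases k with
  | zero => simp [swapLaplacian]
  | succ k =>
    have h := dirichletForm_eq X k 1 f
    simp only [pairDiff_one, Pi.zero_apply, zero_mul, Finset.sum_const_zero, Pi.one_apply,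
      one_mul] at h
    linarith

/-- The induction rests on `r (n - 1 - r) + n = (r + 1) (n - r)`, with `n = |X|`; at `r = 0` the
Laplacian has total zero. -/
theorem levelForm_swapLaplacian_left (r j : ℕ) (X : Finset V) (f g : Finset V → ℝ) :
    levelForm r j X (swapLaplacian X f) g = r * (X.card + 1 - r) * levelForm r j X f g := by
  induction r generalizing X f g with
  | zero => simp [levelForm, sum_swapLaplacian]
  | succ r ih =>
    rw [levelForm, levelForm, Finset.mul_sum]
    refine Finset.sum_congr rfl fun p hp => ?_
    obtain ⟨ha, hb, hab⟩ := Finset.mem_offDiag.1 hp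
    have hc : (X.card : ℝ) = (X \ {p.1, p.2}).card + 2 := by exact_mod_cast (card_sdiff_pair hp).symm
    rw [levelForm_congr_left (f₂ := swapLaplacian (X \ {p.1, p.2}) (pairDiff p.1 p.2 f) +
        (X.card : ℝ) • pairDiff p.1 p.2 f) r j _ _ fun S hS =>
        pairDiff_swapLaplacian ha hb hab (Finset.mem_powersetCard.1 hS).1 f,
      levelForm_add_left, levelForm_smul_left, ih, hc]
    push_cast
    ring

/-- Connectivity of the Johnson graph: exchanging an element of `R \ T` for one of `T \ R` moves `R`
towards `T`. -/
theorem eq_of_pairDiff_eq_zero {X : Finset V} {k : ℕ} {f : Finset V → ℝ}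
    (h : ∀ p ∈ X.offDiag, ∀ S ∈ (X \ {p.1, p.2}).powersetCard k, pairDiff p.1 p.2 f S = 0)
    {R T : Finset V} (hR : R ∈ X.powersetCard (k + 1)) (hT : T ∈ X.powersetCard (k + 1)) :
    f R = f T := by
  induction hm : (R \ T).card generalizing R with
  | zero =>
    rw [Finset.card_eq_zero, Finset.sdiff_eq_empty_iff_subset] at hm
    rw [Finset.mem_powersetCard] at hR hT
    rw [Finset.eq_of_subset_of_card_le hm (by omega)]
  | succ m ih =>
    have hR' := Finset.mem_powersetCard.1 hR
    have hT' := Finset.mem_powersetCard.1 hT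
    have hTR : (T \ R).card = m + 1 := by
      rw [← hm]; exact Finset.card_sdiff_comm (hT'.2.trans hR'.2.symm)
    obtain ⟨a, ha⟩ := Finset.card_pos.1 (by omega : 0 < (R \ T).card)
    obtain ⟨b, hb⟩ := Finset.card_pos.1 (by omega : 0 < (T \ R).card)
    rw [Finset.mem_sdiff] at ha hb
    have hab : a ≠ b := fun h => hb.2 (h ▸ ha.1)
    have hp : (a, b) ∈ X.offDiag := Finset.mem_offDiag.2 ⟨hR'.1 ha.1, hT'.1 hb.1, hab⟩
    have hS : R.erase a ∈ (X \ {a, b}).powersetCard k := by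
      rw [Finset.mem_powersetCard, Finset.card_erase_of_mem ha.1, hR'.2]
      refine ⟨fun x hx => ?_, rfl⟩
      obtain ⟨hxa, hxR⟩ := Finset.mem_erase.1 hx
      have hxb : x ≠ b := fun h => hb.2 (h ▸ hxR)
      simp [hxa, hxb, hR'.1 hxR]
    have h0 := h _ hp _ hS
    rw [pairDiff, Finset.insert_erase ha.1, sub_eq_zero] at h0
    rw [h0]
    refine ih (insert_mem_powersetCard' (hT'.1 hb.1) hS) ?_
    have : insert b (R.erase a) \ T = (R \ T).erase a := by
      ext x
      simp only [Finset.mem_sdiff, Finset.mem_insert, Finset.mem_erase]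
      by_cases hx : x = b
      · subst hx; simp [hb.1]
      · simp only [hx, false_or]; tauto
    rw [this, Finset.card_erase_of_mem (Finset.mem_sdiff.2 ha), hm]; rfl

/-- A functional vanishing on the image of the self-adjoint `L` is represented by some `G` with `L G
= 0`. Its Dirichlet energy is then zero, so `G` is constant, and the value at `1` forces `G = 0`. -/
theorem eq_zero_of_swapLaplacian_of_one (X : Finset V) (k : ℕ) (hX : k + 1 ≤ X.card)
    (Λ : (Finset V → ℝ) →ₗ[ℝ] ℝ)
    (hcongr : ∀ f₁ f₂ : Finset V → ℝ, (∀ R ∈ X.powersetCard (k + 1), f₁ R = f₂ R) → Λ f₁ = Λ f₂)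
    (hlap : ∀ f, Λ (swapLaplacian X f) = 0) (hone : Λ 1 = 0) : Λ = 0 := by
  set G : Finset V → ℝ := fun R => Λ (Pi.single R 1) with hG
  have hrep : ∀ f, Λ f = ∑ R ∈ X.powersetCard (k + 1), f R * G R := by
    intro f
    rw [hcongr f (∑ R ∈ X.powersetCard (k + 1), f R • Pi.single R 1)]
    · simp [hG]
    · intro R hR
      simp [Finset.sum_apply, Pi.single_apply, hR]
  have hLG : ∀ R ∈ X.powersetCard (k + 1), swapLaplacian X G R = 0 := by
    intro R hR
    have h := hlap (Pi.single R 1)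
    rw [hrep, ← sum_mul_swapLaplacian_comm] at h
    simpa [Pi.single_apply, hR] using h
  have hdir := dirichletForm_eq X k G G
  have h0 : ∑ R ∈ X.powersetCard (k + 1), G R * swapLaplacian X G R = 0 :=
    Finset.sum_eq_zero fun R hR => by rw [hLG R hR, mul_zero]
  rw [h0, mul_zero, Finset.sum_eq_zero_iff_of_nonneg
      (fun p _ => Finset.sum_nonneg fun S _ => mul_self_nonneg _)] at hdir
  have hz : ∀ p ∈ X.offDiag, ∀ S ∈ (X \ {p.1, p.2}).powersetCard k, pairDiff p.1 p.2 G S = 0 := by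
    intro p hp S hS
    have := (Finset.sum_eq_zero_iff_of_nonneg (fun S _ => mul_self_nonneg _)).1 (hdir p hp) S hS
    exact mul_self_eq_zero.1 this
  obtain ⟨T, hT⟩ := Finset.powersetCard_nonempty.2 hX
  have hconst : ∀ R ∈ X.powersetCard (k + 1), G R = G T := fun R hR =>
    eq_of_pairDiff_eq_zero hz hR hT
  have hGT : G T = 0 := by
    rw [hrep, Finset.sum_congr rfl fun R hR => by rw [hconst R hR]] at hone
    simp only [Pi.one_apply, one_mul, Finset.sum_const, Finset.card_powersetCard,
      nsmul_eq_mul, mul_eq_zero, Nat.cast_eq_zero] at hone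
    exact hone.resolve_left (Nat.choose_pos hX).ne'
  ext1 f
  rw [hrep, Finset.sum_eq_zero fun R hR => by rw [hconst R hR, hGT, mul_zero]]
  rfl

/-- The coefficient of `levelForm r (k - r)` in the Plancherel identity on `k`-subsets of an
`n`-element set. -/
noncomputable def levelCoeff : ℕ → ℕ → ℕ → ℝ
  | n, k, 0 => (n.choose k : ℝ)⁻¹
  | _, 0, _ + 1 => 0
  | n, k + 1, r + 1 => levelCoeff (n - 2) k r / (2 * ((r + 1) * (n - r)))

theorem levelForm_zero_left (r j : ℕ) (X : Finset V) (g : Finset V → ℝ) :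
    levelForm r j X 0 g = 0 := by
  simpa using levelForm_smul_left r j X 0 0 g

theorem sum_mul_eq_sum_levelForm (k : ℕ) (X : Finset V) (hX : 2 * k ≤ X.card)
    (f g : Finset V → ℝ) :
    ∑ R ∈ X.powersetCard k, f R * g R =
      ∑ r ∈ Finset.range (k + 1), levelCoeff X.card k r * levelForm r (k - r) X f g := by
  induction k generalizing X f g with
  | zero => simp [levelCoeff, levelForm]
  | succ k ih =>
    -- The defect of the identity, as a linear functional of `f` with `g` fixed.
    let Λ : (Finset V → ℝ) →ₗ[ℝ] ℝ :=
      { toFun := fun f => ∑ R ∈ X.powersetCard (k + 1), f R * g R -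
          ∑ r ∈ Finset.range (k + 1 + 1), levelCoeff X.card (k + 1) r *
            levelForm r (k + 1 - r) X f g
        map_add' := fun f₁ f₂ => by
          simp only [levelForm_add_left, Pi.add_apply, add_mul, mul_add, Finset.sum_add_distrib]
          ring
        map_smul' := fun c f => by
          simp only [levelForm_smul_left, Pi.smul_apply, smul_eq_mul, RingHom.id_apply, mul_sub,
            Finset.mul_sum, mul_assoc, mul_left_comm c] }
    suffices hΛ : Λ = 0 from sub_eq_zero.1 (LinearMap.congr_fun hΛ f)
    refine eq_zero_of_swapLaplacian_of_one X k (by omega) Λ ?_ ?_ ?_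
    · intro f₁ f₂ h
      change (_ : ℝ) - _ = _ - _
      congr 1
      · exact Finset.sum_congr rfl fun R hR => by rw [h R hR]
      · refine Finset.sum_congr rfl fun r hr => ?_
        rw [levelForm_congr_left]
        rwa [Nat.sub_add_cancel (by simp at hr; omega)]
    · intro f
      change (_ : ℝ) - _ = 0
      have hE := dirichletForm_eq X k f g
      rw [sum_mul_swapLaplacian_comm] at hE
      have hE' : ∑ p ∈ X.offDiag, ∑ S ∈ (X \ {p.1, p.2}).powersetCard k,
          pairDiff p.1 p.2 f S * pairDiff p.1 p.2 g S =
          ∑ r ∈ Finset.range (k + 1), levelCoeff (X.card - 2) k r *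
            levelForm (r + 1) (k - r) X f g := by
        simp only [levelForm, Finset.mul_sum]
        rw [Finset.sum_comm]
        refine Finset.sum_congr rfl fun p hp => ?_
        have hc := card_sdiff_pair hp
        rw [ih _ (by omega), show (X \ {p.1, p.2}).card = X.card - 2 by omega]
      -- The term `r = 0` has eigenvalue zero. In the others the eigenvalue `(r + 1) (n - r)` and
      -- the Dirichlet factor `2` cancel the denominator in `levelCoeff`.
      rw [Finset.sum_range_succ', sub_eq_zero]
      rw [← mul_right_inj' (two_ne_zero (α := ℝ)), ← hE, hE', levelForm_swapLaplacian_left]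
      simp only [Nat.cast_zero, zero_mul, mul_zero, add_zero, Finset.mul_sum]
      refine Finset.sum_congr rfl fun r hr => ?_
      have hr' : r < k + 1 := Finset.mem_range.1 hr
      have h1 : (X.card : ℝ) - r ≠ 0 := by
        rw [sub_ne_zero]; exact_mod_cast (by omega : X.card ≠ r)
      have h2 : (r : ℝ) + 1 ≠ 0 := by positivity
      rw [levelCoeff, levelForm_swapLaplacian_left, Nat.add_sub_add_right]
      push_cast
      field_simp
      ring
    · change (_ : ℝ) - _ = 0
      rw [Finset.sum_range_succ', sub_eq_zero]
      have h1 : ∀ r ∈ Finset.range (k + 1), levelCoeff X.card (k + 1) (r + 1) *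
          levelForm (r + 1) (k + 1 - (r + 1)) X 1 g = 0 := fun r _ => by
        simp [levelForm, pairDiff_one, levelForm_zero_left]
      have h2 : ((X.card.choose (k + 1) : ℕ) : ℝ) ≠ 0 :=
        Nat.cast_ne_zero.2 (Nat.choose_pos (by omega)).ne'
      rw [Finset.sum_eq_zero h1]
      simp [levelCoeff, levelForm, h2]

end JohnsonScheme

/-! ### Iterated derivatives as signed sums over transversals. -/

section PairSequences

variable {V : Type*} [DecidableEq V]

/-- The entries of `q` are disjoint pairs of distinct elements of `X`. -/
def IsPairSeq {r : ℕ} (X : Finset V) (q : Fin r → V × V) : Prop :=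
  (∀ i, q i ∈ X.offDiag) ∧
    ∀ i j, i ≠ j → Disjoint ({(q i).1, (q i).2} : Finset V) {(q j).1, (q j).2}

instance {r : ℕ} (X : Finset V) (q : Fin r → V × V) : Decidable (IsPairSeq X q) :=
  inferInstanceAs (Decidable (_ ∧ _))

/-- The sum over the transversals `R` of the pairs in `q` of `f R`, weighted by `ε` to the number
of second entries contained in `R`. -/
def transversalSum {r : ℕ} (ε : ℝ) (k : ℕ) (X : Finset V) (q : Fin r → V × V)
    (f : Finset V → ℝ) : ℝ :=
  ∑ R ∈ X.powersetCard k with ∀ i, ((q i).1 ∈ R ↔ (q i).2 ∉ R),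
    ε ^ (R ∩ Finset.univ.image fun i => (q i).2).card * f R

theorem isPairSeq_cons {r : ℕ} (X : Finset V) (p : V × V) (q : Fin r → V × V) :
    IsPairSeq X (Fin.cons p q : Fin (r + 1) → V × V) ↔
      p ∈ X.offDiag ∧ IsPairSeq (X \ {p.1, p.2}) q := by
  simp only [IsPairSeq, Fin.forall_fin_succ, Fin.cons_zero, Fin.cons_succ, ne_eq, Fin.succ_inj,
    Finset.mem_offDiag, Finset.mem_sdiff, Finset.mem_insert, Finset.mem_singleton,
    Finset.disjoint_insert_left, Finset.disjoint_singleton_left, Fin.succ_ne_zero,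
    (Fin.succ_ne_zero _).symm, not_true, not_false_iff, forall_true_left, false_imp_iff, true_and]
  constructor
  · rintro ⟨⟨h1, h2⟩, h3, h4⟩
    refine ⟨h1, fun i => ?_, fun i j hij => (h4 i).2 j hij⟩
    have := h3 i
    have := h2 i
    tauto
  · rintro ⟨h1, h2, h3⟩
    refine ⟨⟨h1, fun i => ?_⟩, fun i => ?_, fun i => ⟨?_, h3 i⟩⟩ <;>
    · have := h2 i
      have e1 := eq_comm (a := p.1) (b := (q i).1)
      have e2 := eq_comm (a := p.1) (b := (q i).2)
      have e3 := eq_comm (a := p.2) (b := (q i).1)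
      have e4 := eq_comm (a := p.2) (b := (q i).2)
      tauto

/-- A transversal contains exactly one point of the first pair. Deleting it leaves a transversal of
the other pairs, and the weight loses a factor `ε` if that point was `p.2`. Thus `ε = -1` yields
derivatives and `ε = 1` yields counts. -/
theorem transversalSum_cons {r : ℕ} (ε : ℝ) (k : ℕ) {X : Finset V} {p : V × V}
    {q : Fin r → V × V} (h : IsPairSeq X (Fin.cons p q : Fin (r + 1) → V × V))
    (f : Finset V → ℝ) :
    transversalSum ε (k + 1) X (Fin.cons p q : Fin (r + 1) → V × V) f =
      transversalSum ε k (X \ {p.1, p.2}) q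
        fun S => f (insert p.1 S) + ε * f (insert p.2 S) := by
  obtain ⟨hp, hq⟩ := (isPairSeq_cons X p q).1 h
  obtain ⟨a, b⟩ := p
  obtain ⟨ha, hb, hab⟩ := Finset.mem_offDiag.1 hp
  dsimp only at ha hb hab hq ⊢
  set B : Finset V := Finset.univ.image fun i => (q i).2 with hB
  have hB' : (Finset.univ.image fun i => (Fin.cons (a, b) q : Fin (r + 1) → V × V) i |>.2) =
      insert b B := by
    ext x
    simp [Fin.exists_fin_succ, hB, eq_comm]
  have hq1 : ∀ i, (q i).1 ≠ a ∧ (q i).1 ≠ b ∧ (q i).2 ≠ a ∧ (q i).2 ≠ b := fun i => by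
    have := Finset.mem_offDiag.1 (hq.1 i)
    simp only [Finset.mem_sdiff, Finset.mem_insert, Finset.mem_singleton] at this
    tauto
  have haB : a ∉ B := by
    simp only [hB, Finset.mem_image, Finset.mem_univ, true_and, not_exists]
    exact fun i => (hq1 i).2.2.1
  simp only [transversalSum, mul_add, Finset.sum_add_distrib, hB', ← hB]
  rw [← Finset.sum_filter_add_sum_filter_not _ (fun R => a ∈ R)]
  have hS : ∀ S ∈ (X \ {a, b}).powersetCard k, a ∉ S ∧ b ∉ S := fun S hS =>
    ⟨fun h => by simpa using (Finset.mem_powersetCard.1 hS).1 h,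
      fun h => by simpa using (Finset.mem_powersetCard.1 hS).1 h⟩
  have herase : ∀ c d R, ({c, d} : Finset V) = {a, b} → R ∈ X.powersetCard (k + 1) → c ∈ R →
      d ∉ R → R.erase c ∈ (X \ {a, b}).powersetCard k := by
    intro c d R hcd hR hc hd
    rw [Finset.mem_powersetCard] at hR ⊢
    rw [← hcd, Finset.card_erase_of_mem hc, hR.2]
    refine ⟨fun x hx => ?_, rfl⟩
    obtain ⟨hxa, hxR⟩ := Finset.mem_erase.1 hx
    have hxb : x ≠ d := fun h => hd (h ▸ hxR)
    simp [hxa, hxb, hR.1 hxR]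
  congr 1
  · refine Finset.sum_bij' (fun R _ => R.erase a) (fun S _ => insert a S) ?_ ?_ ?_ ?_ ?_
    · intro R hR
      simp only [Finset.mem_filter, Fin.forall_fin_succ, Fin.cons_zero, Fin.cons_succ] at hR ⊢
      refine ⟨herase a b R rfl hR.1.1 hR.2 (hR.1.2.1.1 hR.2), fun i => ?_⟩
      simp [(hq1 i).1, (hq1 i).2.2.1, hR.1.2.2 i]
    · intro S hS'
      simp only [Finset.mem_filter, Fin.forall_fin_succ, Fin.cons_zero, Fin.cons_succ] at hS' ⊢
      refine ⟨⟨insert_mem_powersetCard ha hS'.1, ?_, fun i => ?_⟩, Finset.mem_insert_self _ _⟩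
      · simp [hab.symm, (hS S hS'.1).2]
      · simp [(hq1 i).1, (hq1 i).2.2.1, hS'.2 i]
    · intro R hR
      exact Finset.insert_erase (Finset.mem_filter.1 hR).2
    · intro S hS'
      exact Finset.erase_insert (hS S (Finset.mem_filter.1 hS').1).1
    · intro R hR
      simp only [Finset.mem_filter, Fin.forall_fin_succ, Fin.cons_zero, Fin.cons_succ] at hR
      rw [Finset.insert_erase hR.2, Finset.inter_insert_of_notMem (hR.1.2.1.1 hR.2),
        Finset.erase_inter, Finset.erase_eq_of_notMem (by simp [haB])]
  · refine Finset.sum_bij' (fun R _ => R.erase b) (fun S _ => insert b S) ?_ ?_ ?_ ?_ ?_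
    · intro R hR
      simp only [Finset.mem_filter, Fin.forall_fin_succ, Fin.cons_zero, Fin.cons_succ] at hR ⊢
      refine ⟨herase b a R (Finset.pair_comm _ _) hR.1.1 (by tauto) hR.2, fun i => ?_⟩
      simp [(hq1 i).2.1, (hq1 i).2.2.2, hR.1.2.2 i]
    · intro S hS'
      simp only [Finset.mem_filter, Fin.forall_fin_succ, Fin.cons_zero, Fin.cons_succ] at hS' ⊢
      refine ⟨⟨insert_mem_powersetCard' hb hS'.1, ?_, fun i => ?_⟩, ?_⟩
      · simp [hab, (hS S hS'.1).1]
      · simp [(hq1 i).2.1, (hq1 i).2.2.2, hS'.2 i]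
      · simp [hab, (hS S hS'.1).1]
    · intro R hR
      simp only [Finset.mem_filter, Fin.forall_fin_succ, Fin.cons_zero, Fin.cons_succ] at hR
      exact Finset.insert_erase (by tauto)
    · intro S hS'
      exact Finset.erase_insert (hS S (Finset.mem_filter.1 hS').1).2
    · intro R hR
      simp only [Finset.mem_filter, Fin.forall_fin_succ, Fin.cons_zero, Fin.cons_succ] at hR
      have hbR : b ∈ R := by tauto
      have hbB : b ∉ B := by
        simp only [hB, Finset.mem_image, Finset.mem_univ, true_and, not_exists]
        exact fun i => (hq1 i).2.2.2
      rw [Finset.insert_erase hbR, Finset.inter_insert_of_mem hbR, Finset.erase_inter,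
        Finset.erase_eq_of_notMem (by simp [hbB]), Finset.card_insert_of_notMem (by simp [hbB])]
      ring

theorem levelForm_self [Fintype V] (r j : ℕ) (X : Finset V) (f : Finset V → ℝ) :
    levelForm r j X f f =
      ∑ q : Fin r → V × V with IsPairSeq X q, transversalSum (-1) (j + r) X q f ^ 2 := by
  induction r generalizing X f with
  | zero =>
    have : ∀ q : Fin 0 → V × V, IsPairSeq X q := fun q => ⟨fun i => i.elim0, fun i => i.elim0⟩
    simp [levelForm, transversalSum, this, sq]
  | succ r ih =>
    rw [Finset.sum_filter, ← (Fin.consEquiv fun _ => V × V).sum_comp, Fintype.sum_prod_type,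
      levelForm, ← Finset.univ_inter X.offDiag, ← Finset.filter_mem_eq_inter, Finset.sum_filter]
    refine Finset.sum_congr rfl fun p _ => ?_
    split_ifs with hp
    · rw [ih, Finset.sum_filter]
      refine Finset.sum_congr rfl fun q _ => ?_
      change _ = if IsPairSeq X (Fin.cons p q : Fin (r + 1) → V × V) then
        transversalSum (-1) (j + r + 1) X (Fin.cons p q : Fin (r + 1) → V × V) f ^ 2 else 0
      by_cases hq : IsPairSeq (X \ {p.1, p.2}) q
      · have hc := (isPairSeq_cons X p q).2 ⟨hp, hq⟩
        rw [if_pos hq, if_pos hc, transversalSum_cons _ _ hc]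
        simp only [neg_one_mul, ← sub_eq_add_neg]
        rfl
      · rw [if_neg hq, if_neg fun hc => hq ((isPairSeq_cons X p q).1 hc).2]
    · rw [Finset.sum_eq_zero]
      exact fun q _ => if_neg fun hc => hp ((isPairSeq_cons X p q).1 hc).1

theorem transversalSum_one_const {r : ℕ} (j : ℕ) {X : Finset V} {q : Fin r → V × V}
    (h : IsPairSeq X q) (c : ℝ) :
    transversalSum 1 (j + r) X q (fun _ => c) = c * (2 ^ r * (X.card - 2 * r).choose j) := by
  induction r generalizing X c with
  | zero => simp [transversalSum, mul_comm]
  | succ r ih =>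
    obtain ⟨p, q, rfl⟩ : ∃ p q', q = (Fin.cons p q' : Fin (r + 1) → V × V) :=
      ⟨q 0, Fin.tail q, (Fin.cons_self_tail q).symm⟩
    obtain ⟨hp, hq⟩ := (isPairSeq_cons X p q).1 h
    have hc := card_sdiff_pair hp
    rw [← add_assoc, transversalSum_cons _ _ h, ih hq,
      show X.card - 2 * (r + 1) = (X \ {p.1, p.2}).card - 2 * r by omega]
    ring

/-- The sequence of pairs underlying an element of `PairPerm`. -/
def PairPerm.toSeq {r : ℕ} (p : PairPerm V r) (i : Fin r) : V × V := (p (i, 0), p (i, 1))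

theorem PairPerm.isPairSeq_toSeq [Fintype V] {r : ℕ} (p : PairPerm V r) :
    IsPairSeq Finset.univ p.toSeq := by
  refine ⟨fun i => ?_, fun i j hij => ?_⟩
  · simp [PairPerm.toSeq]
  · simp [PairPerm.toSeq, Ne.symm hij]

theorem sum_pairPerm [Fintype V] {r : ℕ} (F : (Fin r → V × V) → ℝ) :
    ∑ p : PairPerm V r, F p.toSeq = ∑ q : Fin r → V × V with IsPairSeq Finset.univ q, F q := by
  refine Finset.sum_bij (fun p _ => p.toSeq) ?_ ?_ ?_ fun _ _ => rfl
  · exact fun p _ => Finset.mem_filter.2 ⟨Finset.mem_univ _, p.isPairSeq_toSeq⟩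
  · intro p _ p' _ h
    ext ⟨i, x⟩
    have := congrFun h i
    simp only [PairPerm.toSeq, Prod.mk.injEq] at this
    fin_cases x
    · exact this.1
    · exact this.2
  · intro q hq
    obtain ⟨h1, h2⟩ := (Finset.mem_filter.1 hq).2
    refine ⟨⟨fun x => if x.2 = 0 then (q x.1).1 else (q x.1).2, ?_⟩, Finset.mem_univ _, ?_⟩
    · rintro ⟨i, x⟩ ⟨j, y⟩ h
      have hij : i = j := by
        by_contra hij
        have h3 := Finset.disjoint_left.1 (h2 i j hij)
          (show (if x = 0 then (q i).1 else (q i).2) ∈ _ by split_ifs <;> simp)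
        refine h3 ?_
        dsimp only at h
        rw [h]
        split_ifs <;> simp
      subst hij
      have h4 := (Finset.mem_offDiag.1 (h1 i)).2.2
      fin_cases x <;> fin_cases y <;> simp_all [Ne.symm]
    · ext i
      · rfl
      · rfl

theorem card_inter_pair_eq_one_iff {a b : V} (hab : a ≠ b) (R : Finset V) :
    (R ∩ {a, b}).card = 1 ↔ (a ∈ R ↔ b ∉ R) := by
  by_cases ha : a ∈ R <;> by_cases hb : b ∈ R <;>
    simp [Finset.inter_insert_of_mem, Finset.inter_insert_of_notMem, Finset.inter_singleton_of_mem,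
      Finset.inter_singleton_of_notMem, ha, hb, hab]

end PairSequences

/-! ### Comparison with the level weights and the variance. -/

section Weights

variable {V : Type*} {k : ℕ}

/-- The extension by zero of a function on `k`-subsets to all subsets. -/
noncomputable def extendZero (f : KSubset V k → ℝ) (R : Finset V) : ℝ :=
  if h : R.card = k then f ⟨R, h⟩ else 0

theorem extendZero_coe (f : KSubset V k → ℝ) (R : KSubset V k) : extendZero f R.1 = f R :=
  dif_pos R.2

theorem sum_kSubset [Fintype V] (G : Finset V → ℝ) :
    ∑ R : KSubset V k, G R.1 = ∑ R ∈ Finset.univ.powersetCard k, G R :=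
  (Finset.sum_subtype _ (fun R => by simp) G).symm

variable [Fintype V] [DecidableEq V]

theorem sum_transversals {r : ℕ} (ε : ℝ) (p : PairPerm V r) (f : KSubset V k → ℝ) :
    ∑ R ∈ transversals k p, ε ^ (R.1 ∩ bSet p).card * f R =
      transversalSum ε k Finset.univ p.toSeq (extendZero f) := by
  rw [transversalSum, Finset.sum_filter, ← sum_kSubset, transversals, Finset.sum_filter]
  refine Finset.sum_congr rfl fun R _ => ?_
  have h : ∀ i, p (i, 0) ≠ p (i, 1) := fun i => by simp
  simp only [card_inter_pair_eq_one_iff (h _), extendZero_coe]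
  rfl

theorem card_transversals {r j : ℕ} (p : PairPerm V r) :
    ((transversals (j + r) p).card : ℝ) = 2 ^ r * (Fintype.card V - 2 * r).choose j := by
  have h1 := sum_transversals 1 p (fun _ : KSubset V (j + r) => (1 : ℝ))
  have h2 := transversalSum_one_const j p.isPairSeq_toSeq 1
  have h3 : transversalSum 1 (j + r) Finset.univ p.toSeq
      (extendZero fun _ : KSubset V (j + r) => (1 : ℝ)) =
      transversalSum 1 (j + r) Finset.univ p.toSeq fun _ => 1 := by
    refine Finset.sum_congr rfl fun R hR => ?_
    rw [extendZero, dif_pos (Finset.mem_powersetCard.1 (Finset.mem_filter.1 hR).1).2]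
  rw [h3, h2] at h1
  simpa using h1

/-- Averages become sums: there are `descFactorial` many pair sequences, all with the same number of
transversals, which enters squared. -/
theorem levelForm_eq_levelWeight_sq {r : ℕ} (hr : r ≤ k) (hV : 2 * k ≤ Fintype.card V)
    (f : KSubset V k → ℝ) :
    levelForm r (k - r) Finset.univ (extendZero f) (extendZero f) =
      (Fintype.card V).descFactorial (2 * r) *
        (2 ^ r * ((Fintype.card V - 2 * r).choose (k - r) : ℝ)) ^ 2 * levelWeight r f ^ 2 := by
  obtain ⟨j, rfl⟩ : ∃ j, k = j + r := ⟨k - r, by omega⟩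
  rw [Nat.add_sub_cancel, levelForm_self, levelWeight, Real.sq_sqrt
    (Finset.expect_nonneg fun p _ => sq_nonneg _), ← sum_pairPerm]
  set N : ℝ := 2 ^ r * ((Fintype.card V - 2 * r).choose j : ℝ) with hN
  have hN0 : N ≠ 0 := by
    have : 0 < (Fintype.card V - 2 * r).choose j := Nat.choose_pos (by omega)
    positivity
  have hD : ((Fintype.card V).descFactorial (2 * r) : ℝ) ≠ 0 :=
    Nat.cast_ne_zero.2 (Nat.descFactorial_pos.2 (by omega)).ne'
  have hcard : Fintype.card (PairPerm V r) = (Fintype.card V).descFactorial (2 * r) := by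
    rw [Fintype.card_embedding_eq]; simp [mul_comm]
  simp only [Finset.expect_eq_sum_div_card, card_transversals, Finset.card_univ, hcard, ← hN,
    sum_transversals, div_pow, ← Finset.sum_div]
  field_simp

theorem levelCoeff_mul_le (n k r : ℕ) (hr : r ≤ k) (hn : 2 * k ≤ n) :
    levelCoeff n k r * (n.descFactorial (2 * r) * (2 ^ r * ((n - 2 * r).choose (k - r) : ℝ)) ^ 2) ≤
      2 ^ r * k.choose r * n.choose k := by
  induction r generalizing n k with
  | zero =>
    have : ((n.choose k : ℕ) : ℝ) ≠ 0 := Nat.cast_ne_zero.2 (Nat.choose_pos (by omega)).ne'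
    simp [levelCoeff]
    field_simp
    rfl
  | succ r ih =>
    obtain ⟨k, rfl⟩ : ∃ k', k = k' + 1 := ⟨k - 1, by omega⟩
    obtain ⟨n, rfl⟩ : ∃ n', n = n' + 2 := ⟨n - 2, by omega⟩
    have h := ih n k (by omega) (by omega)
    rw [levelCoeff, Nat.add_sub_cancel, Nat.add_sub_add_right,
      show n + 2 - 2 * (r + 1) = n - 2 * r by omega, show 2 * (r + 1) = 2 * r + 1 + 1 by ring,
      Nat.succ_descFactorial_succ, Nat.succ_descFactorial_succ]
    set A : ℝ := levelCoeff n k r *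
      (n.descFactorial (2 * r) * (2 ^ r * ((n - 2 * r).choose (k - r) : ℝ)) ^ 2) with hA
    have hnk : (k : ℝ) + r + 1 ≤ n + 1 := by exact_mod_cast (by omega : k + r + 1 ≤ n + 1)
    have hrk : (r : ℝ) ≤ k := by exact_mod_cast (by omega : r ≤ k)
    have hd : (0 : ℝ) < (r + 1) * ((n + 2 : ℕ) - r) := by
      push_cast
      have : (0 : ℝ) ≤ k := Nat.cast_nonneg k
      exact mul_pos (by positivity) (by linarith)
    have e1 : ((k + 1).choose (r + 1) : ℝ) * (r + 1) = (k + 1) * k.choose r := by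
      exact_mod_cast (Nat.add_one_mul_choose_eq k r).symm
    have e2 : ((n + 2).choose (k + 1) : ℝ) * (k + 1) = (n + 2) * (n + 1).choose k := by
      exact_mod_cast (Nat.add_one_mul_choose_eq (n + 1) k).symm
    have e3 : ((n + 1).choose k : ℝ) * (n + 1 - k) = (n + 1) * n.choose k := by
      have := Nat.choose_mul_succ_eq n k
      have hk : k ≤ n + 1 := by omega
      have h' : (((n + 1).choose k * (n + 1 - k) : ℕ) : ℝ) = ((n + 1) * n.choose k : ℕ) := by
        rw [← this, mul_comm]
      rw [Nat.cast_mul, Nat.cast_sub hk] at h'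
      push_cast at h'
      exact h'
    have hC : (0 : ℝ) ≤ (k + 1).choose (r + 1) * (n + 2).choose (k + 1) := by positivity
    -- Passing from `(n, k, r)` to `(n + 2, k + 1, r + 1)` multiplies the left side by `2 (n + 2) (n
    -- + 1) / ((r + 1) (n + 2 - r))`. The bound grows by the same factor with `n + 1 - k` in place
    -- of `n + 2 - r`, and `n + 1 - k ≤ n + 2 - r` since `r ≤ k`.
    have key : 2 * (n + 2 : ℝ) * (n + 1) * (2 ^ r * k.choose r * n.choose k) ≤
        2 ^ (r + 1) * (k + 1).choose (r + 1) * (n + 2).choose (k + 1) *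
          ((r + 1) * ((n + 2 : ℕ) - r)) := by
      have e4 : 2 * (n + 2 : ℝ) * (n + 1) * (2 ^ r * k.choose r * n.choose k) =
          2 ^ (r + 1) * (k + 1).choose (r + 1) * (n + 2).choose (k + 1) *
            ((r + 1) * (n + 1 - k)) := by
        have hk : (k + 1 : ℝ) ≠ 0 := by positivity
        apply mul_left_cancel₀ hk
        linear_combination (-(2 : ℝ) ^ (r + 1) * (n + 2) * (k.choose r) * (k + 1)) * e3
          - (2 : ℝ) ^ (r + 1) * (k.choose r) * (k + 1) * (n + 1 - k) * e2
          - (2 : ℝ) ^ (r + 1) * (n + 2).choose (k + 1) * (k + 1) * (n + 1 - k) * e1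
      rw [e4]
      push_cast
      gcongr
      linarith
    have hA' : levelCoeff n k r / (2 * ((r + 1) * ((n + 2 : ℕ) - r))) *
        ((n + 1 + 1) * ((n + 1) * (n.descFactorial (2 * r) : ℝ)) *
          (2 ^ (r + 1) * ((n - 2 * r).choose (k - r) : ℝ)) ^ 2) =
        2 * (n + 2 : ℝ) * (n + 1) * A / ((r + 1) * ((n + 2 : ℕ) - r)) := by
      rw [hA]
      field_simp
      ring
    push_cast at hA' hd key ⊢
    rw [hA', div_le_iff₀ hd]
    exact le_trans (by gcongr) key

theorem uniformVar_eq (hV : k ≤ Fintype.card V) (f : KSubset V k → ℝ) :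
    (Fintype.card V).choose k * uniformVar f =
      ∑ R : KSubset V k, f R ^ 2 -
        ((Fintype.card V).choose k : ℝ)⁻¹ * (∑ R : KSubset V k, f R) ^ 2 := by
  have hc : Fintype.card (KSubset V k) = (Fintype.card V).choose k := by
    rw [Fintype.card_finset_len]
  have h0 : (((Fintype.card V).choose k : ℕ) : ℝ) ≠ 0 :=
    Nat.cast_ne_zero.2 (Nat.choose_pos hV).ne'
  simp only [uniformVar, Finset.expect_eq_sum_div_card, Finset.card_univ, hc, sub_sq,
    Finset.sum_add_distrib, Finset.sum_sub_distrib, ← Finset.sum_mul, ← Finset.mul_sum,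
    Finset.sum_const, nsmul_eq_mul]
  field_simp
  ring

theorem uniformVar_le (hV : 2 * k ≤ Fintype.card V) (f : KSubset V k → ℝ) :
    uniformVar f ≤
      ∑ r ∈ Finset.range k, 2 ^ (r + 1) * k.choose (r + 1) * levelWeight (r + 1) f ^ 2 := by
  have hC : (0 : ℝ) < (Fintype.card V).choose k := Nat.cast_pos.2 (Nat.choose_pos (by omega))
  refine le_of_mul_le_mul_left ?_ hC
  have h := sum_mul_eq_sum_levelForm k Finset.univ (by simpa using hV) (extendZero f)
    (extendZero f)
  -- The term `r = 0` split off here is exactly the squared mean subtracted in `uniformVar_eq`.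
  rw [Finset.sum_range_succ', ← sum_kSubset] at h
  simp only [levelCoeff, levelForm.eq_1, Nat.sub_zero, ← sum_kSubset, extendZero_coe,
    Finset.card_univ] at h
  rw [uniformVar_eq (by omega), sub_le_iff_le_add]
  simp only [sq (f _), sq (∑ R, f R)]
  rw [h, Finset.mul_sum (Finset.range k)]
  refine add_le_add (Finset.sum_le_sum fun r hr => ?_) le_rfl
  have hr : r + 1 ≤ k := Finset.mem_range.1 hr
  have := mul_le_mul_of_nonneg_right (levelCoeff_mul_le (Fintype.card V) k (r + 1) hr hV)
    (sq_nonneg (levelWeight (r + 1) f))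
  rw [levelForm_eq_levelWeight_sq hr hV]
  linarith

end Weights

/-! ### From the variance bound to the maximal level weight. -/

theorem mainTheorem9 (n k : ℕ) (hk : 1 ≤ k) (hn : 2 * k ≤ n) (f : KSubset (Fin n) k → ℝ) :
    (Finset.Icc 1 k).sup' (Finset.nonempty_Icc.mpr hk) (fun r => levelWeight r f) ≥
      (5 : ℝ) ^ (-(k : ℝ) / 2) * Real.sqrt (uniformVar f) := by
  set M := (Finset.Icc 1 k).sup' (Finset.nonempty_Icc.mpr hk) (fun r => levelWeight r f) with hM
  have hle : ∀ r ∈ Finset.Icc 1 k, levelWeight r f ≤ M := fun r hr =>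
    Finset.le_sup' (fun r => levelWeight r f) hr
  have hM0 : 0 ≤ M := (Real.sqrt_nonneg _).trans (hle 1 (Finset.mem_Icc.2 ⟨le_rfl, hk⟩))
  have hvar : uniformVar f ≤ 5 ^ k * M ^ 2 := by
    calc uniformVar f
        ≤ ∑ r ∈ Finset.range k, 2 ^ (r + 1) * k.choose (r + 1) * levelWeight (r + 1) f ^ 2 :=
          uniformVar_le (by simpa using hn) f
      _ ≤ ∑ r ∈ Finset.range k, 2 ^ (r + 1) * k.choose (r + 1) * M ^ 2 := by
          gcongr with r hr
          · exact Real.sqrt_nonneg _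
          · exact hle _ (Finset.mem_Icc.2 ⟨by omega, Finset.mem_range.1 hr⟩)
      _ ≤ 3 ^ k * M ^ 2 := by
          rw [← Finset.sum_mul]
          gcongr
          -- Expanding `(2 + 1) ^ k`, the sum lacks only the term `1` at `r = 0`.
          have h := add_pow (2 : ℝ) 1 k
          rw [Finset.sum_range_succ'] at h
          norm_num at h
          rw [h]
          linarith
      _ ≤ 5 ^ k * M ^ 2 := by gcongr; norm_num
  have h5 : (5 : ℝ) ^ (-(k : ℝ) / 2) = (Real.sqrt (5 ^ k))⁻¹ := by
    rw [Real.sqrt_eq_rpow, ← Real.rpow_natCast, ← Real.rpow_mul (by norm_num),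
      ← Real.rpow_neg (by norm_num)]
    congr 1
    ring
  rw [ge_iff_le, h5, inv_mul_le_iff₀ (by positivity), ← Real.sqrt_sq hM0,
    ← Real.sqrt_mul (by positivity)]
  exact Real.sqrt_le_sqrt hvar
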